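/- Let $W:\mathcal X\to\mathcal S_=(\mathcal H_{Y_1}\otimes\cdots\otimes\mathcal H_{Y_L})$, $x\mapsto\rho^x_{Y_{[1:L]}}$, be a classical-quantum broadcast channel from a finite alphabet $\mathcal X$ to $L$ users holding finite-dimensional quantum systems. Let $\mathbb A\subseteq 2^{[1:L]}$ be a monotone (upward closed) access structure and let $\mathbb B\triangleq 2^{[1:L]}\setminus\mathbb A$ be the unauthorized sets. For $\mathcal D\subseteq[1:L]$, $\rho^x_{Y_{\mathcal D}}$ is the partial trace of $\rho^x_{Y_{[1:L]}}$ over the systems of the users outside $\mathcal D$. Logarithms are to base $2$, with $\log 0=-\infty$. A $2^R$-code, where $2^R$ is a positive integer, consists of the secret set $\mathcal S=\{1,\dots,2^R\}$, an encoder $\mathsf{Enc}:\mathcal S\to\mathcal X$ and, for each $\mathcal A\in\mathbb A$, a decoding measurement (POVM) $\mathsf{Dec}_{\mathcal A}$ on $\mathcal H_{Y_{\mathcal A}}$ with outcomes in $\mathcal S$. For $\epsilon\ge 0$ it is $\epsilon$-good if, for a uniformly distributed secret $S$, $$\Pr\{S\neq\mathsf{Dec}_{\mathcal A}(\rho_{Y_{\mathcal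 A}}^{\mathsf{Enc}(S)})\}\le\epsilon\quad\text{for all }\mathcal A\in\mathbb A,$$ and for every $\mathcal B\in\mathbb B$ there is a state $\sigma_{Y_{\mathcal B}}$ on $\mathcal H_{Y_{\mathcal B}}$ with $$\Big\|\sum_{s\in\mathcal S}\tfrac1{|\mathcal S|}|s\rangle\langle s|\otimes\rho_{Y_{\mathcal B}}^{\mathsf{Enc}(s)}-\tfrac{\mathbb 1_S}{|\mathcal S|}\otimes\sigma_{Y_{\mathcal B}}\Big\|_1\le\epsilon .$$ For positive semidefinite $\rho,\sigma$ let $F(\rho,\sigma)=\|\sqrt\rho\sqrt\sigma\|_1^2$; for subnormalized states let $P(\rho,\sigma)=\sqrt{1-F(\rho,\sigma)}$, and let $\mathcal B_\epsilon(\rho)$ be the set of subnormalized states $\tilde\rho$ with $P(\rho,\tilde\rho)\le\epsilon$. With $\sigma_B$ ranging over normalized states, define $$H_{\min}(A|B)_\rho=\max_{\sigma_B}\sup\{\lambda\in\mathbb R:\rho_{AB}\le2^{-\lambda}\mathbb 1_A\otimes\sigma_B\},\qquad H_{\max}(A|B)_\rho=\max_{\sigma_B}\log F(\rho_{AB},\mathbb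 1_A\otimes\sigma_B),$$ $$H_{\min}^{\epsilon}(A|B)_\rho=\max_{\tilde\rho\in\mathcal B_\epsilon(\rho_{AB})}H_{\min}(A|B)_{\tilde\rho},\qquad H_{\max}^{\epsilon}(A|B)_\rho=\min_{\tilde\rho\in\mathcal B_\epsilon(\rho_{AB})}H_{\max}(A|B)_{\tilde\rho},$$ with values in $[-\infty,+\infty]$. Then the rate $R$ of every $\epsilon$-good $2^R$-code satisfies $$R\le\max_{P_{SX}}\Big[\min_{\mathcal B\in\mathbb B}H_{\min}^{\sqrt\epsilon}(S|Y_{\mathcal B})_\psi-\max_{\mathcal A\in\mathbb A}H_{\max}^{\sqrt{2\epsilon}}(S|Y_{\mathcal A})_\psi\Big],\qquad \psi_{SXY_{[1:L]}}=\sum_{s\in\mathcal S}\sum_{x\in\mathcal X}P_{SX}(s,x)\,|s\rangle\langle s|\otimes|x\rangle\langle x|\otimes\rho^x_{Y_{[1:L]}},$$ where the maximum is over all probability distributions $P_{SX}$ on $\mathcal S\times\mathcal X$, and a minimum (maximum) over an empty family of sets is $+\infty$ ($-\infty$). -/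

import Mathlib

open scoped Kronecker ComplexOrder MatrixOrder

namespace SecretSharing

noncomputable section

/-! ### States, distances and entropies

A finite-dimensional Hilbert space is `ℂ ^ n` for a finite index type `n`, operators are matrices
over `ℂ`, a tensor product is indexed by the product of the index types, and the Loewner order is
`ρ ≤ σ ↔ (σ - ρ).PosSemidef`. All logarithms are to base 2. -/

section States

variable {n : Type*} [Fintype n]

/-- Normalized quantum states: positive semidefinite operators of trace one. -/
def IsState (ρ : Matrix n n ℂ) : Prop :=
  0 ≤ ρ ∧ ρ.trace = 1

/-- Subnormalized quantum states: positive semidefinite operators of trace at most one. -/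
def IsSubState (ρ : Matrix n n ℂ) : Prop :=
  0 ≤ ρ ∧ ρ.trace.re ≤ 1

variable [DecidableEq n]

/-- The trace norm `‖A‖₁ = Tr √(A† A)`. -/
def traceNorm (A : Matrix n n ℂ) : ℝ :=
  (CFC.sqrt (A.conjTranspose * A)).trace.re

/-- The fidelity `F(ρ, σ) = ‖√ρ √σ‖₁²` of positive semidefinite operators. -/
def fidelity (ρ σ : Matrix n n ℂ) : ℝ :=
  traceNorm (CFC.sqrt ρ * CFC.sqrt σ) ^ 2

/-- The purified distance `P(ρ, σ) = √(1 - F(ρ, σ))`. -/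
def purifiedDistance (ρ σ : Matrix n n ℂ) : ℝ :=
  Real.sqrt (1 - fidelity ρ σ)

/-- The ball `B_ε(ρ)` of subnormalized states at purified distance at most `ε` from `ρ`. -/
def smoothingBall (ε : ℝ) (ρ : Matrix n n ℂ) : Set (Matrix n n ℂ) :=
  {τ | IsSubState τ ∧ purifiedDistance ρ τ ≤ ε}

end States

/-- The logarithm to base 2 of a nonnegative real number, with `log 0 = -∞`. -/
def log2 (x : ℝ) : EReal :=
  if x ≤ 0 then ⊥ else ((Real.logb 2 x : ℝ) : EReal)

section Entropies

variable {a b : Type*} [Fintype a] [Fintype b] [DecidableEq a]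

/-- The conditional min-entropy `H_min(A|B)_ρ`, the supremum over all states `σ_B` and all real `r`
with `ρ_AB ≤ 2 ^ (-r) • 1_A ⊗ σ_B` of `r`. -/
def Hmin (ρ : Matrix (a × b) (a × b) ℂ) : EReal :=
  ⨆ (σ : Matrix b b ℂ) (_ : IsState σ),
    ⨆ (r : ℝ) (_ : ρ ≤ ((2 : ℝ) ^ (-r)) • ((1 : Matrix a a ℂ) ⊗ₖ σ)), (r : EReal)

variable [DecidableEq b]

/-- The conditional max-entropy `H_max(A|B)_ρ = max_σ log F(ρ_AB, 1_A ⊗ σ_B)`. -/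
def Hmax (ρ : Matrix (a × b) (a × b) ℂ) : EReal :=
  ⨆ (σ : Matrix b b ℂ) (_ : IsState σ), log2 (fidelity ρ ((1 : Matrix a a ℂ) ⊗ₖ σ))

/-- The smooth conditional min-entropy `H_min^ε(A|B)_ρ`. -/
def smoothHmin (ε : ℝ) (ρ : Matrix (a × b) (a × b) ℂ) : EReal :=
  ⨆ τ ∈ smoothingBall ε ρ, Hmin τ

/-- The smooth conditional max-entropy `H_max^ε(A|B)_ρ`. -/
def smoothHmax (ε : ℝ) (ρ : Matrix (a × b) (a × b) ℂ) : EReal :=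
  ⨅ τ ∈ smoothingBall ε ρ, Hmax τ

end Entropies

/-! ### The broadcast channel -/

section Channel

variable {L : ℕ}

/-- Basis indices of `H_{Y_{[1:L]}} = H_{Y_1} ⊗ ⋯ ⊗ H_{Y_L}`, where `dim H_{Y_l} = d l`. -/
abbrev Joint (d : Fin L → ℕ) : Type :=
  ∀ l : Fin L, Fin (d l)

/-- Basis indices of `H_{Y_A} = ⨂_{l ∈ A} H_{Y_l}`, the joint system of the users in `A`. -/
abbrev Sub (d : Fin L → ℕ) (A : Finset (Fin L)) : Type :=
  ∀ l : {l : Fin L // l ∈ A}, Fin (d l)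

/-- Basis indices of the joint system of the users that are not in `A`. -/
abbrev CoSub (d : Fin L → ℕ) (A : Finset (Fin L)) : Type :=
  ∀ l : {l : Fin L // l ∉ A}, Fin (d l)

/-- The basis index of the whole system with the given parts on `A` and off `A`. -/
def glue {d : Fin L → ℕ} (A : Finset (Fin L)) (y : Sub d A) (z : CoSub d A) : Joint d :=
  (Equiv.piEquivPiSubtypeProd (fun l => l ∈ A) (fun l => Fin (d l))).symm (y, z)

/-- The reduced operator on `Y_A`: the partial trace over the systems of all users not in `A`. -/
def reduce {d : Fin L → ℕ} (A : Finset (Fin L)) (ρ : Matrix (Joint d) (Joint d) ℂ) :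
    Matrix (Sub d A) (Sub d A) ℂ :=
  Matrix.of fun y y' => ∑ z : CoSub d A, ρ (glue A y z) (glue A y' z)

/-- A classical-quantum broadcast channel `x ↦ ρ^x_{Y_{[1:L]}}` from the alphabet `X` to `L` users,
user `l` holding a quantum system of dimension `d l`. -/
structure CQBroadcastChannel (X : Type*) (d : Fin L → ℕ) where
  /-- the output state for the input `x` -/
  out : X → Matrix (Joint d) (Joint d) ℂ
  isState : ∀ x, IsState (out x)

end Channel

/-! ### Secret-sharing codes -/

section Codes

variable {L : ℕ}

/-- A measurement on `ℂ ^ n` with outcomes in `S` (a positive operator-valued measure). -/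
structure Measurement (S n : Type*) [Fintype S] [DecidableEq n] where
  /-- the operator of the outcome `s` -/
  op : S → Matrix n n ℂ
  nonneg : ∀ s, 0 ≤ op s
  sum_eq_one : ∑ s, op s = 1

/-- A secret-sharing code with `M` secrets for the access structure `𝔸`: an encoder and, for every
authorized set `A ∈ 𝔸`, a decoding measurement on the joint system `Y_A`. -/
structure Code (X : Type*) (d : Fin L → ℕ) (𝔸 : Set (Finset (Fin L))) (M : ℕ) where
  /-- the encoder -/
  enc : Fin M → X
  /-- the decoders -/
  dec : ∀ A ∈ 𝔸, Measurement (Fin M) (Sub d A)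

variable {X : Type*} {d : Fin L → ℕ} {𝔸 : Set (Finset (Fin L))} {M : ℕ}

/-- The probability `Pr{S ≠ Dec_A(ρ_{Y_A}^{Enc(S)})}` for a uniformly distributed secret `S`. -/
def Code.errorProb (C : Code X d 𝔸 M) (W : CQBroadcastChannel X d) (A : Finset (Fin L))
    (hA : A ∈ 𝔸) : ℝ :=
  ∑ s : Fin M, (1 / (M : ℝ)) *
    ∑ s' ∈ Finset.univ.erase s, ((C.dec A hA).op s' * reduce A (W.out (C.enc s))).trace.re

/-- The state `∑ₛ (1 / M) |s⟩⟨s| ⊗ ρ_{Y_B}^{Enc(s)}` of the secret and the systems in `B`. -/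
def Code.inducedState (C : Code X d 𝔸 M) (W : CQBroadcastChannel X d) (B : Finset (Fin L)) :
    Matrix (Fin M × Sub d B) (Fin M × Sub d B) ℂ :=
  ∑ s : Fin M, (1 / (M : ℂ)) • (Matrix.single s s (1 : ℂ) ⊗ₖ reduce B (W.out (C.enc s)))

/-- The maximally mixed state on `ℂ ^ M`. -/
def maximallyMixed (M : ℕ) : Matrix (Fin M) (Fin M) ℂ :=
  (1 / (M : ℂ)) • 1

/-- A code is `ε`-good if every authorized set decodes with error probability at most `ε`, and for
every unauthorized set `B` the induced state is `ε`-close in trace norm to the product of the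
maximally mixed state with some state `σ` on `Y_B`. -/
def Code.IsGood (C : Code X d 𝔸 M) (W : CQBroadcastChannel X d) (ε : ℝ) : Prop :=
  (∀ (A : Finset (Fin L)) (hA : A ∈ 𝔸), C.errorProb W A hA ≤ ε) ∧
    ∀ B ∉ 𝔸, ∃ σ : Matrix (Sub d B) (Sub d B) ℂ, IsState σ ∧
      traceNorm (C.inducedState W B - maximallyMixed M ⊗ₖ σ) ≤ ε

end Codes

/-! ### The state in the converse bound -/

section Converse

variable {L : ℕ} {X : Type*} [Fintype X] [DecidableEq X] {d : Fin L → ℕ} {M : ℕ}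

/-- The state `ψ_{SXY} = ∑_{s,x} P(s,x) |s⟩⟨s| ⊗ |x⟩⟨x| ⊗ ρ^x_{Y_{[1:L]}}`. -/
def psi (W : CQBroadcastChannel X d) (P : Fin M × X → ℝ) :
    Matrix (Fin M × X × Joint d) (Fin M × X × Joint d) ℂ :=
  ∑ s : Fin M, ∑ x : X,
    (P (s, x) : ℂ) • (Matrix.single s s (1 : ℂ) ⊗ₖ (Matrix.single x x (1 : ℂ) ⊗ₖ W.out x))

/-- The marginal on `S Y_D` of an operator on `S X Y_{[1:L]}`: the partial trace over `X` and over
the systems of all users not in `D`. -/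
def marginal (D : Finset (Fin L))
    (ρ : Matrix (Fin M × X × Joint d) (Fin M × X × Joint d) ℂ) :
    Matrix (Fin M × Sub d D) (Fin M × Sub d D) ℂ :=
  Matrix.of fun i j => ∑ x : X, ∑ z : CoSub d D,
    ρ (i.1, x, glue D i.2 z) (j.1, x, glue D j.2 z)

end Converse

end

end SecretSharing

namespace SecretSharing

open Matrix

/-! ### Trace inequalities, polar decomposition and trace-norm duality. -/

section TraceNorm

variable {n : Type*} [Fintype n]

/-! Take for `P` the law of a uniform secret and its encoding, so that `marginal B (psi W P)` is the
code's induced state. It then suffices that every unauthorized min-entropy is at least `R` and every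
authorized max-entropy is at most `0`. Secrecy: smooth to the ideal state `2^(-R) • 1 ⊗ σ`, whose
min-entropy is at least `R`; Powers–Størmer turns trace distance `ε` into root fidelity at least `1
- ε/2`. Decoding: let `Λ` be the block sum of the POVM elements and smooth `ρ` to `Λ ρ Λ`. Its root
fidelity with `ρ` is at least `Tr Λρ ≥ 1 - ε`, and with `1 ⊗ σ` it is at most `1`, by Cauchy–Schwarz
and `Tr Λ(1 ⊗ σ) = 1`. -/

theorem trace_re_mul_conjTranspose_self_nonneg (A : Matrix n n ℂ) : 0 ≤ (A * Aᴴ).trace.re :=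
  (Complex.le_def.1 (posSemidef_self_mul_conjTranspose A).trace_nonneg).1

/-- Expand the squared Frobenius norm of `X - Yᴴ`. This is Cauchy–Schwarz in arithmetic-mean form,
which loses nothing when both norms have the same bound. -/
theorem two_mul_trace_re_mul_le (X Y : Matrix n n ℂ) :
    2 * (X * Y).trace.re ≤ (X * Xᴴ).trace.re + (Yᴴ * Y).trace.re := by
  have h := trace_re_mul_conjTranspose_self_nonneg (X - Yᴴ)
  have h₁ : (Yᴴ * Xᴴ).trace.re = (X * Y).trace.re := by
    rw [← conjTranspose_mul, trace_conjTranspose]; simp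
  simp only [conjTranspose_sub, conjTranspose_conjTranspose, sub_mul, mul_sub, trace_sub,
    Complex.sub_re] at h
  linarith

variable [DecidableEq n]

theorem sqrt_conjTranspose (A : Matrix n n ℂ) : (CFC.sqrt A)ᴴ = CFC.sqrt A :=
  (nonneg_iff_posSemidef.1 (CFC.sqrt_nonneg A)).isHermitian

theorem trace_mul_re_nonneg {A B : Matrix n n ℂ} (hA : 0 ≤ A) (hB : 0 ≤ B) :
    0 ≤ (A * B).trace.re := by
  rw [← CFC.sqrt_mul_sqrt_self A hA, ← CFC.sqrt_mul_sqrt_self B hB]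
  have h := trace_re_mul_conjTranspose_self_nonneg (CFC.sqrt A * CFC.sqrt B)
  rw [conjTranspose_mul, sqrt_conjTranspose, sqrt_conjTranspose] at h
  rw [Matrix.mul_assoc, trace_mul_comm]
  simpa only [Matrix.mul_assoc] using h

theorem trace_mul_re_le_left {A B C : Matrix n n ℂ} (h : A ≤ B) (hC : 0 ≤ C) :
    (A * C).trace.re ≤ (B * C).trace.re := by
  have := trace_mul_re_nonneg (sub_nonneg.2 h) hC
  simp only [sub_mul, trace_sub, Complex.sub_re] at this
  linarith

/-- Multiplication by a contraction on the right does not increase the Frobenius norm. -/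
theorem trace_re_mul_contraction_le {U : Matrix n n ℂ} (hU : U * Uᴴ ≤ 1) (X : Matrix n n ℂ) :
    ((X * U) * (X * U)ᴴ).trace.re ≤ (X * Xᴴ).trace.re := by
  have h := trace_mul_re_le_left hU (nonneg_iff_posSemidef.2 (posSemidef_conjTranspose_mul_self X))
  rw [Matrix.one_mul, trace_mul_comm Xᴴ X, ← Matrix.mul_assoc, trace_mul_comm] at h
  simpa only [conjTranspose_mul, Matrix.mul_assoc] using h

/-- A polar decomposition. -/
theorem exists_polar (A : Matrix n n ℂ) :
    ∃ U : Matrix n n ℂ, U * Uᴴ ≤ 1 ∧ U * A = CFC.sqrt (Aᴴ * A) ∧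
      A = Uᴴ * CFC.sqrt (Aᴴ * A) := by
  have hAA : 0 ≤ Aᴴ * A := nonneg_iff_posSemidef.2 (posSemidef_conjTranspose_mul_self A)
  have hTT := CFC.sqrt_mul_sqrt_self (Aᴴ * A) hAA
  have hTH := sqrt_conjTranspose (Aᴴ * A)
  generalize CFC.sqrt (Aᴴ * A) = T at hTT hTH ⊢
  have hT : IsSelfAdjoint T := hTH
  have hcont (f : ℝ → ℝ) : ContinuousOn f (spectrum ℝ T) := T.finite_real_spectrum.continuousOn f
  -- Pseudo-inverse of `T`: since `0⁻¹ = 0`, `N * T` is the support projection. Hence `N * Aᴴ` is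
  -- only a contraction, which suffices.
  set N : Matrix n n ℂ := cfc (fun x : ℝ => x⁻¹) T with hN
  have hNH : Nᴴ = N := cfc_predicate (fun x : ℝ => x⁻¹) T
  have hNT : N * T = cfc (fun x : ℝ => x⁻¹ * x) T := by
    rw [cfc_mul _ _ T (hcont _) (hcont _), cfc_id' ℝ T]
  have hTN : T * N = cfc (fun x : ℝ => x⁻¹ * x) T := by
    rw [← cfc_congr (fun x _ => mul_comm x x⁻¹), cfc_mul _ _ T (hcont _) (hcont _), cfc_id' ℝ T]
  have hcomm : N * T = T * N := hNT.trans hTN.symm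
  have hNTT : N * T * T = T := by
    have h := cfc_mul (fun x : ℝ => x⁻¹ * x) (fun x => x) T (hcont _) (hcont _)
    rw [← hNT, cfc_id' ℝ T] at h
    rw [← h]
    conv_rhs => rw [← cfc_id' ℝ T]
    exact cfc_congr fun x _ => by simp
  have hle : T * N ≤ 1 := by
    rw [hTN]
    refine cfc_le_one _ _ fun x _ => ?_
    exact inv_mul_le_one
  refine ⟨N * Aᴴ, ?_, ?_, ?_⟩
  · rw [conjTranspose_mul, conjTranspose_conjTranspose, hNH, Matrix.mul_assoc, ← Matrix.mul_assoc Aᴴ,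
      ← hTT, ← Matrix.mul_assoc, ← Matrix.mul_assoc, hNTT]
    exact hle
  · rw [Matrix.mul_assoc, ← hTT, ← Matrix.mul_assoc, hNTT]
  -- The difference `A * (1 - N * T)` vanishes because its Gram matrix contains `T * (1 - N * T) =
  -- 0`.
  · rw [conjTranspose_mul, conjTranspose_conjTranspose, hNH, ← sub_eq_zero,
      ← conjTranspose_mul_self_eq_zero]
    have e : A - A * N * T = A * (1 - N * T) := by
      rw [Matrix.mul_sub, Matrix.mul_one, Matrix.mul_assoc]
    have e₂ : T * (1 - N * T) = 0 := by
      rw [Matrix.mul_sub, ← Matrix.mul_assoc, ← hcomm, hNTT, Matrix.mul_one, sub_self]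
    rw [e, conjTranspose_mul, Matrix.mul_assoc, ← Matrix.mul_assoc Aᴴ, ← hTT, Matrix.mul_assoc T, e₂,
      Matrix.mul_zero, Matrix.mul_zero]

theorem traceNorm_nonneg (A : Matrix n n ℂ) : 0 ≤ traceNorm A :=
  (Complex.le_def.1 (nonneg_iff_posSemidef.1 (CFC.sqrt_nonneg (Aᴴ * A))).trace_nonneg).1

/-- The trace norm dominates the pairing with every contraction. -/
theorem trace_re_mul_le_traceNorm {U : Matrix n n ℂ} (hU : U * Uᴴ ≤ 1) (A : Matrix n n ℂ) :
    (A * U).trace.re ≤ traceNorm A := by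
  obtain ⟨V, hV, -, hA⟩ := exists_polar A
  unfold traceNorm
  have hT := CFC.sqrt_nonneg (Aᴴ * A)
  generalize CFC.sqrt (Aᴴ * A) = T at hT hA ⊢
  have hTT := CFC.sqrt_mul_sqrt_self T hT
  have hTH := sqrt_conjTranspose T
  generalize CFC.sqrt T = Q at hTT hTH
  -- Splitting `T = Q * Q` gives two factors, each of squared Frobenius norm at most `Tr T`.
  have h := two_mul_trace_re_mul_le (Q * U) (Vᴴ * Q)
  have e : ((Q * U) * (Vᴴ * Q)).trace = (A * U).trace := by
    rw [hA, ← hTT, trace_mul_comm]; simp only [Matrix.mul_assoc]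
  have h₁ := trace_re_mul_contraction_le hU Q
  have h₂ := trace_re_mul_contraction_le hV Q
  rw [hTH, hTT] at h₁ h₂
  have e₂ : (Vᴴ * Q)ᴴ * (Vᴴ * Q) = Q * V * (Q * V)ᴴ := by
    simp only [conjTranspose_mul, conjTranspose_conjTranspose, hTH]
  rw [e, e₂] at h
  linarith

theorem trace_re_le_traceNorm (A : Matrix n n ℂ) : A.trace.re ≤ traceNorm A := by
  simpa using trace_re_mul_le_traceNorm (U := 1) (by simp) A

end TraceNorm

/-! ### Fidelity estimates. -/

section Fidelity

variable {n : Type*} [Fintype n] [DecidableEq n]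

/-- The Powers–Størmer inequality, for the square roots. -/
theorem trace_re_sq_sub_le_traceNorm {A B : Matrix n n ℂ} (hA : 0 ≤ A) (hB : 0 ≤ B) :
    ((A - B) * (A - B)).trace.re ≤ traceNorm (A * A - B * B) := by
  have hD : IsSelfAdjoint (A - B) :=
    ((nonneg_iff_posSemidef.1 hA).isHermitian.sub (nonneg_iff_posSemidef.1 hB).isHermitian)
  obtain ⟨D, hDdef⟩ : ∃ D, D = A - B := ⟨_, rfl⟩
  rw [← hDdef] at hD ⊢
  have hcont (f : ℝ → ℝ) : ContinuousOn f (spectrum ℝ D) := D.finite_real_spectrum.continuousOn f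
  -- Pairing with the sign of `D` gives `Tr |D|(A + B)`, which dominates `Tr D(A - B)` because `±D ≤
  -- |D|`. The value `1` at zero makes `U` unitary.
  let sg : ℝ → ℝ := fun x => if 0 ≤ x then 1 else -1
  have hsg (x : ℝ) : sg x * sg x = 1 := by by_cases h : 0 ≤ x <;> simp [sg, h]
  have hsa (x : ℝ) : sg x * x = |x| := by
    by_cases h : 0 ≤ x
    · simp [sg, h, abs_of_nonneg]
    · simp [sg, h, abs_of_neg (not_le.1 h)]
  set U : Matrix n n ℂ := cfc sg D with hU
  set N : Matrix n n ℂ := cfc (fun x : ℝ => |x|) D with hN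
  have hUH : Uᴴ = U := cfc_predicate sg D
  have hUU : U * Uᴴ = 1 := by
    rw [hUH, hU, ← cfc_mul _ _ D (hcont _) (hcont _)]
    simp only [hsg]
    exact cfc_const_one ℝ D
  have hUD : U * D = N := by
    rw [hN, ← cfc_congr (fun x _ => hsa x), cfc_mul _ _ D (hcont _) (hcont _), cfc_id' ℝ D]
  have hDU : D * U = N := by
    rw [hN, ← cfc_congr (fun x _ => (mul_comm _ _).trans (hsa x)),
      cfc_mul _ _ D (hcont _) (hcont _), cfc_id' ℝ D]
  have h₁ : D ≤ N := by
    conv_lhs => rw [← cfc_id' ℝ D]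
    exact cfc_mono (fun x _ => le_abs_self x) (hcont _) (hcont _)
  have h₂ : -D ≤ N := by
    conv_lhs => rw [← cfc_id' ℝ D, ← cfc_neg]
    exact cfc_mono (fun x _ => neg_le_abs x) (hcont _) (hcont _)
  have h₃ := trace_mul_re_le_left h₁ hA
  have h₄ := trace_mul_re_le_left h₂ hB
  have h₅ := trace_re_mul_le_traceNorm hUU.le (A * A - B * B)
  have e : A * A - B * B = A * D + D * B := by
    rw [hDdef, mul_sub, sub_mul]; abel
  have e₂ : ((A * A - B * B) * U).trace = (N * A).trace + (N * B).trace := by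
    rw [e, add_mul, trace_add, Matrix.mul_assoc, hDU, trace_mul_comm A N, Matrix.mul_assoc,
      trace_mul_comm D, Matrix.mul_assoc, hUD, trace_mul_comm B N]
  have e₃ : D * D = D * A - D * B := by rw [← mul_sub, ← hDdef]
  rw [e₂] at h₅
  rw [e₃]
  simp only [trace_sub, Complex.sub_re, Complex.add_re, neg_mul, trace_neg, Complex.neg_re] at *
  linarith

/-- The lower Fuchs–van de Graaf inequality. -/
theorem one_sub_half_traceNorm_le {ρ σ : Matrix n n ℂ} (hρ : IsState ρ) (hσ : IsState σ) :
    1 - traceNorm (ρ - σ) / 2 ≤ traceNorm (CFC.sqrt ρ * CFC.sqrt σ) := by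
  have h := trace_re_sq_sub_le_traceNorm (CFC.sqrt_nonneg ρ) (CFC.sqrt_nonneg σ)
  have h' := trace_re_le_traceNorm (CFC.sqrt ρ * CFC.sqrt σ)
  rw [CFC.sqrt_mul_sqrt_self ρ hρ.1, CFC.sqrt_mul_sqrt_self σ hσ.1] at h
  simp only [sub_mul, mul_sub, trace_sub, CFC.sqrt_mul_sqrt_self ρ hρ.1,
    CFC.sqrt_mul_sqrt_self σ hσ.1, hρ.2, hσ.2, trace_mul_comm (CFC.sqrt σ) (CFC.sqrt ρ),
    Complex.sub_re, Complex.one_re] at h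
  linarith

/-- From `t² ≥ 2t - 1`. Taking `δ = ε` and `δ = 2ε` gives the two smoothing radii. -/
theorem purifiedDistance_le_sqrt {ρ σ : Matrix n n ℂ} {δ : ℝ}
    (h : 1 - δ / 2 ≤ traceNorm (CFC.sqrt ρ * CFC.sqrt σ)) :
    purifiedDistance ρ σ ≤ √δ := by
  apply Real.sqrt_le_sqrt
  unfold fidelity
  have := traceNorm_nonneg (CFC.sqrt ρ * CFC.sqrt σ)
  nlinarith [sq_nonneg (traceNorm (CFC.sqrt ρ * CFC.sqrt σ) - 1)]

/-- `Λ - Λ² = Λ(1 - Λ)Λ + (1 - Λ)Λ(1 - Λ)`. -/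
theorem mul_self_le_self {Λ : Matrix n n ℂ} (h₀ : 0 ≤ Λ) (h₁ : Λ ≤ 1) : Λ * Λ ≤ Λ := by
  have hΛ := (nonneg_iff_posSemidef.1 h₀).isHermitian
  have hΛ' := (le_iff.1 h₁).isHermitian
  have h₂ := ((le_iff.1 h₁).conjTranspose_mul_mul_same Λ).add
    ((nonneg_iff_posSemidef.1 h₀).conjTranspose_mul_mul_same (1 - Λ))
  rw [hΛ.eq, hΛ'.eq] at h₂
  rw [le_iff]
  convert h₂ using 1
  noncomm_ring

/-- The fidelity of a state with its image under `ρ ↦ Λ ρ Λ`. -/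
theorem trace_re_mul_le_traceNorm_sqrt {ρ Λ : Matrix n n ℂ} (hρ : 0 ≤ ρ) (hΛ : Λᴴ = Λ) :
    (Λ * ρ).trace.re ≤ traceNorm (CFC.sqrt ρ * CFC.sqrt (Λ * ρ * Λ)) := by
  have hρρ := CFC.sqrt_mul_sqrt_self ρ hρ
  have hρH := sqrt_conjTranspose ρ
  generalize CFC.sqrt ρ = Q at hρρ hρH ⊢
  -- The modulus of `√ρ Λ` is `√(Λ ρ Λ)`, so its polar factor is the contraction to pair with.
  obtain ⟨U, hU, -, hX⟩ := exists_polar (Q * Λ)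
  have e : (Q * Λ)ᴴ * (Q * Λ) = Λ * ρ * Λ := by
    rw [← hρρ, conjTranspose_mul, hρH, hΛ]; simp only [Matrix.mul_assoc]
  rw [e] at hX
  have hT := sqrt_conjTranspose (Λ * ρ * Λ)
  generalize CFC.sqrt (Λ * ρ * Λ) = T at hX hT ⊢
  have h := trace_re_mul_le_traceNorm hU (Q * T)
  have hX' : Λ * Q = T * U := by
    have := congrArg conjTranspose hX
    simpa [conjTranspose_mul, hρH, hΛ, hT] using this
  rwa [Matrix.mul_assoc, ← hX', trace_mul_comm, Matrix.mul_assoc, hρρ] at h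

/-- Up to polar factors the trace norm pairs `√ρ` with `Λ √ω`, whose squared Frobenius norms are `Tr
ρ = 1` and `Tr Λ²ω ≤ Tr Λω ≤ 1`. -/
theorem traceNorm_sqrt_le_one {ρ Λ ω : Matrix n n ℂ} (hρ : IsState ρ) (h₀ : 0 ≤ Λ) (h₁ : Λ ≤ 1)
    (hω : 0 ≤ ω) (hΛω : (Λ * ω).trace.re ≤ 1) :
    traceNorm (CFC.sqrt (Λ * ρ * Λ) * CFC.sqrt ω) ≤ 1 := by
  have hΛ : Λᴴ = Λ := (nonneg_iff_posSemidef.1 h₀).isHermitian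
  have hle := trace_mul_re_le_left (mul_self_le_self h₀ h₁) hω
  have hρρ := CFC.sqrt_mul_sqrt_self ρ hρ.1
  have hρH := sqrt_conjTranspose ρ
  generalize CFC.sqrt ρ = Q at hρρ hρH
  have hωω := CFC.sqrt_mul_sqrt_self ω hω
  have hωH := sqrt_conjTranspose ω
  generalize CFC.sqrt ω = K at hωω hωH ⊢
  obtain ⟨U, hU, hX, -⟩ := exists_polar (Q * Λ)
  have e : (Q * Λ)ᴴ * (Q * Λ) = Λ * ρ * Λ := by
    rw [← hρρ, conjTranspose_mul, hρH, hΛ]; simp only [Matrix.mul_assoc]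
  rw [e] at hX
  rw [← hX]
  obtain ⟨V, hV, hY, -⟩ := exists_polar (U * (Q * Λ) * K)
  unfold traceNorm
  rw [← hY]
  have h := two_mul_trace_re_mul_le Q (Λ * K * V * U)
  have hKU := trace_re_mul_contraction_le hU (Λ * K * V)
  have hKV := trace_re_mul_contraction_le hV (Λ * K)
  have hK : ((Λ * K) * (Λ * K)ᴴ).trace = (Λ * Λ * ω).trace := by
    rw [trace_mul_comm, conjTranspose_mul, hΛ, hωH, ← hωω, ← Matrix.mul_assoc, Matrix.mul_assoc K,
      trace_mul_comm, ← Matrix.mul_assoc, trace_mul_comm, Matrix.mul_assoc]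
  have hQ : (Q * (Λ * K * V * U)).trace = (V * (U * (Q * Λ) * K)).trace := by
    rw [trace_mul_comm V, ← Matrix.mul_assoc, trace_mul_comm]
    simp only [Matrix.mul_assoc]
  rw [trace_mul_comm (Λ * K * V * U)ᴴ, hρH, hρρ, hρ.2, hQ] at h
  rw [hK] at hKV
  simp only [Complex.one_re] at h
  linarith

end Fidelity
-- Partial traces of states.
section Reduction

variable {L : ℕ} {d : Fin L → ℕ}

theorem IsState.reduce {ρ : Matrix (Joint d) (Joint d) ℂ} (hρ : IsState ρ) (A : Finset (Fin L)) :
    IsState (reduce A ρ) := by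
  constructor
  -- Each fixed `z` contributes a principal submatrix, hence a positive one.
  · have e : SecretSharing.reduce A ρ =
        ∑ z : CoSub d A, ρ.submatrix (fun y => glue A y z) (fun y => glue A y z) := by
      ext y y'
      simp [SecretSharing.reduce, Matrix.sum_apply]
    rw [e]
    exact Finset.sum_nonneg fun z _ =>
      nonneg_iff_posSemidef.2 ((nonneg_iff_posSemidef.1 hρ.1).submatrix _)
  · rw [← hρ.2]
    simp only [Matrix.trace, SecretSharing.reduce, Matrix.diag_apply, Matrix.of_apply]
    rw [← Fintype.sum_prod_type']
    exact Fintype.sum_equiv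
      (Equiv.piEquivPiSubtypeProd (fun l => l ∈ A) (fun l => Fin (d l))).symm _ _ fun _ => rfl

end Reduction

/-! ### Block-diagonal operators. -/

section BlockOperators

variable {S n : Type*} [Fintype S] [DecidableEq S]

/-- The operator `∑ₛ |s⟩⟨s| ⊗ f s`. -/
noncomputable def blockOp (f : S → Matrix n n ℂ) : Matrix (S × n) (S × n) ℂ :=
  ∑ s, single s s (1 : ℂ) ⊗ₖ f s

theorem blockOp_nonneg [Fintype n] [DecidableEq n] {f : S → Matrix n n ℂ} (hf : ∀ s, 0 ≤ f s) :
    0 ≤ blockOp f := by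
  refine Finset.sum_nonneg fun s _ => nonneg_iff_posSemidef.2 ?_
  refine PosSemidef.kronecker ?_ (nonneg_iff_posSemidef.1 (hf s))
  have := posSemidef_conjTranspose_mul_self (single s s (1 : ℂ))
  simpa using this

theorem blockOp_const (σ : Matrix n n ℂ) :
    blockOp (fun _ : S => σ) = (1 : Matrix S S ℂ) ⊗ₖ σ := by
  ext ⟨s, y⟩ ⟨t, z⟩
  simp only [blockOp, Matrix.sum_apply, kroneckerMap_apply, Matrix.one_apply, ← Finset.sum_mul]
  congr 1
  by_cases h : s = t
  · subst h; simp [single_apply]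
  · rw [if_neg h]
    refine Finset.sum_eq_zero fun u _ => single_apply_of_ne _ _ _ _ _ ?_
    rintro ⟨rfl, rfl⟩
    exact h rfl

theorem blockOp_sub (f g : S → Matrix n n ℂ) :
    blockOp (fun s => f s - g s) = blockOp f - blockOp g := by
  ext ⟨s, y⟩ ⟨t, z⟩
  simp [blockOp, Matrix.sum_apply, mul_sub]

theorem trace_blockOp [Fintype n] (f : S → Matrix n n ℂ) : (blockOp f).trace = ∑ s, (f s).trace := by
  simp [blockOp, trace_sum, trace_kronecker]

theorem blockOp_mul [Fintype n] (f g : S → Matrix n n ℂ) :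
    blockOp f * blockOp g = blockOp (fun s => f s * g s) := by
  simp only [blockOp, Finset.sum_mul, Finset.mul_sum, ← mul_kronecker_mul]
  refine Finset.sum_congr rfl fun s _ => ?_
  rw [Finset.sum_eq_single s]
  · simp
  · intro t _ h
    rw [single_mul_single_of_ne _ _ _ _ h, zero_kronecker]
  · simp

end BlockOperators

theorem Measurement.op_le_one {S n : Type*} [Fintype S] [Fintype n] [DecidableEq n]
    (Λ : Measurement S n) (s : S) : Λ.op s ≤ 1 := by
  rw [← Λ.sum_eq_one]
  exact Finset.single_le_sum (fun t _ => Λ.nonneg t) (Finset.mem_univ s)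

/-! ### Entropy bounds from decoding and secrecy. -/

section Codes

variable {L : ℕ} {X : Type*} {d : Fin L → ℕ} {𝔸 : Set (Finset (Fin L))} {M : ℕ}
  (C : Code X d 𝔸 M) (W : CQBroadcastChannel X d)

theorem Code.inducedState_eq_blockOp (A : Finset (Fin L)) :
    C.inducedState W A = blockOp fun s => (1 / (M : ℂ)) • reduce A (W.out (C.enc s)) := by
  simp only [Code.inducedState, blockOp, kronecker_smul]

theorem one_div_natCast_nonneg (M : ℕ) : (0 : ℂ) ≤ 1 / (M : ℂ) := by
  have : (1 / (M : ℂ)) = ((1 / (M : ℝ) : ℝ) : ℂ) := by push_cast; rfl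
  rw [this]
  exact_mod_cast by positivity

theorem Code.inducedState_isState (hM : 0 < M) (A : Finset (Fin L)) :
    IsState (C.inducedState W A) := by
  have hM' : (M : ℂ) ≠ 0 := by exact_mod_cast hM.ne'
  rw [C.inducedState_eq_blockOp]
  refine ⟨blockOp_nonneg fun s => ?_, ?_⟩
  · exact nonneg_iff_posSemidef.2 ((nonneg_iff_posSemidef.1 ((W.isState _).reduce A).1).smul
      (one_div_natCast_nonneg M))
  · rw [trace_blockOp]
    simp [((W.isState _).reduce A).2, hM']

theorem maximallyMixed_kronecker_isState (hM : 0 < M) {n : Type*} [Fintype n] [DecidableEq n]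
    {σ : Matrix n n ℂ} (hσ : IsState σ) : IsState (maximallyMixed M ⊗ₖ σ) := by
  have hM' : (M : ℂ) ≠ 0 := by exact_mod_cast hM.ne'
  constructor
  · exact nonneg_iff_posSemidef.2 (PosSemidef.kronecker
      (PosSemidef.one.smul (one_div_natCast_nonneg M)) (nonneg_iff_posSemidef.1 hσ.1))
  · rw [trace_kronecker, hσ.2]
    simp [maximallyMixed, hM']

theorem Code.one_sub_errorProb (hM : 0 < M) (A : Finset (Fin L)) (hA : A ∈ 𝔸) :
    1 - C.errorProb W A hA = (blockOp (C.dec A hA).op * C.inducedState W A).trace.re := by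
  have hM' : (M : ℝ) ≠ 0 := by exact_mod_cast hM.ne'
  have key (s : Fin M) :
      ∑ s' ∈ Finset.univ.erase s,
          ((C.dec A hA).op s' * reduce A (W.out (C.enc s))).trace.re =
        1 - ((C.dec A hA).op s * reduce A (W.out (C.enc s))).trace.re := by
    rw [eq_sub_iff_add_eq, Finset.sum_erase_add _ _ (Finset.mem_univ s), ← Complex.re_sum,
      ← trace_sum, ← Finset.sum_mul, (C.dec A hA).sum_eq_one, Matrix.one_mul,
      ((W.isState _).reduce A).2, Complex.one_re]
  have hre (z : ℂ) : ((1 / (M : ℂ)) * z).re = 1 / (M : ℝ) * z.re := by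
    have : (1 / (M : ℂ)) = ((1 / (M : ℝ) : ℝ) : ℂ) := by push_cast; rfl
    rw [this, Complex.re_ofReal_mul]
  rw [C.inducedState_eq_blockOp, blockOp_mul, trace_blockOp, Complex.re_sum]
  simp only [Code.errorProb, key, Matrix.mul_smul, trace_smul, smul_eq_mul, hre, mul_sub,
    Finset.sum_sub_distrib]
  simp [hM']

/-- An authorized set can decode, so its smooth max-entropy about the secret is at most zero. -/
theorem Code.smoothHmax_le_zero (hM : 0 < M) {A : Finset (Fin L)} (hA : A ∈ 𝔸) {ε : ℝ}
    (h : C.errorProb W A hA ≤ ε) :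
    smoothHmax √(2 * ε) (C.inducedState W A) ≤ 0 := by
  have hρ := C.inducedState_isState W hM A
  have hΛ₀ : 0 ≤ blockOp (C.dec A hA).op := blockOp_nonneg (C.dec A hA).nonneg
  have hΛ₁ : blockOp (C.dec A hA).op ≤ 1 := by
    have := blockOp_nonneg fun s => sub_nonneg.2 ((C.dec A hA).op_le_one s)
    rwa [blockOp_sub (fun _ => 1), blockOp_const, one_kronecker_one, sub_nonneg] at this
  -- Against `1 ⊗ σ` the blocks add up to the whole POVM.
  have hΛω (σ : Matrix (Sub d A) (Sub d A) ℂ) (hσ : IsState σ) :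
      (blockOp (C.dec A hA).op * ((1 : Matrix (Fin M) (Fin M) ℂ) ⊗ₖ σ)).trace = 1 := by
    rw [← blockOp_const, blockOp_mul, trace_blockOp, ← trace_sum, ← Finset.sum_mul,
      (C.dec A hA).sum_eq_one, Matrix.one_mul, hσ.2]
  have herr := C.one_sub_errorProb W hM A hA
  generalize blockOp (C.dec A hA).op = Λ at hΛ₀ hΛ₁ hΛω herr
  generalize C.inducedState W A = ρ at hρ herr
  have hΛ : Λᴴ = Λ := (nonneg_iff_posSemidef.1 hΛ₀).isHermitian
  refine iInf₂_le_of_le (Λ * ρ * Λ) ⟨⟨?_, ?_⟩, ?_⟩ (iSup₂_le fun σ hσ => ?_)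
  · have := (nonneg_iff_posSemidef.1 hρ.1).conjTranspose_mul_mul_same Λ
    rw [hΛ] at this
    exact nonneg_iff_posSemidef.2 this
  · rw [trace_mul_comm, ← Matrix.mul_assoc]
    have := trace_mul_re_le_left ((mul_self_le_self hΛ₀ hΛ₁).trans hΛ₁) hρ.1
    rwa [Matrix.one_mul, hρ.2, Complex.one_re] at this
  · apply purifiedDistance_le_sqrt
    have := trace_re_mul_le_traceNorm_sqrt hρ.1 hΛ
    linarith
  · have hω : 0 ≤ (1 : Matrix (Fin M) (Fin M) ℂ) ⊗ₖ σ :=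
      nonneg_iff_posSemidef.2 (PosSemidef.one.kronecker (nonneg_iff_posSemidef.1 hσ.1))
    have hF : fidelity (Λ * ρ * Λ) ((1 : Matrix (Fin M) (Fin M) ℂ) ⊗ₖ σ) ≤ 1 :=
      pow_le_one₀ (traceNorm_nonneg _)
        (traceNorm_sqrt_le_one hρ hΛ₀ hΛ₁ hω (by rw [hΛω σ hσ, Complex.one_re]))
    unfold log2
    split_ifs with h₀
    · exact bot_le
    · exact EReal.coe_le_coe_iff.2
        (Real.logb_nonpos one_lt_two (not_le.1 h₀).le hF)

/-- An unauthorized set is decoupled from the secret, so its smooth min-entropy is at least the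
rate. -/
theorem Code.le_smoothHmin (hM : 0 < M) {R : ℝ} (hR : (M : ℝ) = (2 : ℝ) ^ R) {B : Finset (Fin L)}
    {ε : ℝ} {σ : Matrix (Sub d B) (Sub d B) ℂ} (hσ : IsState σ)
    (h : traceNorm (C.inducedState W B - maximallyMixed M ⊗ₖ σ) ≤ ε) :
    (R : EReal) ≤ smoothHmin √ε (C.inducedState W B) := by
  have hρ := C.inducedState_isState W hM B
  have hτ := maximallyMixed_kronecker_isState hM hσ
  have hle := one_sub_half_traceNorm_le hρ hτ
  -- The ideal state equals `2^(-R) • 1 ⊗ σ`, so `σ` and `R` are feasible with equality.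
  refine le_iSup₂_of_le (maximallyMixed M ⊗ₖ σ)
    ⟨⟨hτ.1, by rw [hτ.2, Complex.one_re]⟩, purifiedDistance_le_sqrt (by linarith)⟩ ?_
  refine le_iSup₂_of_le σ hσ (le_iSup₂_of_le R (le_of_eq ?_) le_rfl)
  rw [Real.rpow_neg zero_le_two, ← hR, maximallyMixed, smul_kronecker, one_div]
  ext i j
  simp only [Matrix.smul_apply, Complex.real_smul, smul_eq_mul]
  push_cast
  rfl

end Codes

/-! ### The code's input distribution and the converse. -/

section Converse

variable {L : ℕ} {X : Type*} [Fintype X] [DecidableEq X] {d : Fin L → ℕ}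
  {𝔸 : Set (Finset (Fin L))} {M : ℕ} (C : Code X d 𝔸 M) (W : CQBroadcastChannel X d)

/-- The joint distribution of a uniformly distributed secret and its encoding. -/
noncomputable def Code.inputDistribution (p : Fin M × X) : ℝ :=
  if C.enc p.1 = p.2 then 1 / (M : ℝ) else 0

theorem Code.inputDistribution_mem_stdSimplex (hM : 0 < M) :
    C.inputDistribution ∈ stdSimplex ℝ (Fin M × X) := by
  have hM' : (M : ℝ) ≠ 0 := by exact_mod_cast hM.ne'
  refine ⟨fun p => ?_, ?_⟩
  · unfold Code.inputDistribution
    split_ifs <;> positivity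
  · rw [Fintype.sum_prod_type]
    simp [Code.inputDistribution, hM']

theorem Code.marginal_psi_inputDistribution (D : Finset (Fin L)) :
    marginal D (psi W C.inputDistribution) = C.inducedState W D := by
  ext ⟨s, y⟩ ⟨t, y'⟩
  have hpsi (x : X) (u v : Joint d) :
      psi W C.inputDistribution (s, x, u) (t, x, v) =
        if s = t then (C.inputDistribution (s, x) : ℂ) * W.out x u v else 0 := by
    simp only [psi, Matrix.sum_apply, Matrix.smul_apply, kroneckerMap_apply, single_apply,
      smul_eq_mul]
    rw [Finset.sum_eq_single s, Finset.sum_eq_single x]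
    · by_cases h : s = t <;> simp [h]
    · intro b _ hb
      simp [hb]
    · simp
    · intro b _ hb
      simp [hb]
    · simp
  have hind : C.inducedState W D (s, y) (t, y') =
      if s = t then (1 / (M : ℂ)) * reduce D (W.out (C.enc s)) y y' else 0 := by
    simp only [Code.inducedState, Matrix.sum_apply, Matrix.smul_apply, kroneckerMap_apply,
      single_apply, smul_eq_mul]
    rw [Finset.sum_eq_single s]
    · by_cases h : s = t <;> simp [h]
    · intro b _ hb
      simp [hb]
    · simp
  rw [hind]
  simp only [marginal, Matrix.of_apply, hpsi]
  by_cases h : s = t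
  · simp only [if_pos h, ← Finset.mul_sum, Code.inputDistribution, reduce, Matrix.of_apply]
    rw [Finset.sum_eq_single (C.enc s)]
    · simp
    · intro b _ hb
      simp [hb.symm]
    · simp
  · simp [h]

end Converse

end SecretSharing

theorem theorem2 {L : ℕ} {X : Type*} [Fintype X] [DecidableEq X] (d : Fin L → ℕ)
    (W : SecretSharing.CQBroadcastChannel X d)
    (𝔸 : Set (Finset (Fin L))) (h𝔸 : IsUpperSet 𝔸)
    (M : ℕ) (R : ℝ) (hR : (M : ℝ) = (2 : ℝ) ^ R)
    (ε : ℝ) (C : SecretSharing.Code X d 𝔸 M) (hC : C.IsGood W ε) :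
    (R : EReal) ≤
      ⨆ P : stdSimplex ℝ (Fin M × X),
        ((⨅ B ∈ 𝔸ᶜ, SecretSharing.smoothHmin (Real.sqrt ε)
            (SecretSharing.marginal B (SecretSharing.psi W P.1))) -
          ⨆ A ∈ 𝔸, SecretSharing.smoothHmax (Real.sqrt (2 * ε))
            (SecretSharing.marginal A (SecretSharing.psi W P.1))) := by
  have hM : 0 < M := by
    have : (0 : ℝ) < M := hR ▸ Real.rpow_pos_of_pos two_pos R
    exact_mod_cast this
  refine le_iSup_of_le ⟨C.inputDistribution, C.inputDistribution_mem_stdSimplex hM⟩ ?_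
  simp only [C.marginal_psi_inputDistribution]
  -- Bounding set by set also covers empty families, vacuously.
  calc (R : EReal) = R - 0 := by simp
    _ ≤ _ := EReal.sub_le_sub
      (le_iInf₂ fun B hB => ?_) (iSup₂_le fun A hA => C.smoothHmax_le_zero W hM hA (hC.1 A hA))
  obtain ⟨σ, hσ, h⟩ := hC.2 B hB
  exact C.le_smoothHmin W hM hR hσ h
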